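/- Let $V$ be a finite set of at least two nodes. A *deterministic protocol with a binary oracle* gives each node an initial state and a deterministic transition function. In an atomic step (an event $(p,m,x)$), a node $p$ receives one message $m$ addressed to it and in transit, or nothing ($m$ null), executes code in which every call to the oracle returns $x\in\{0,1\}$, changes its state, and sends finitely many messages to nodes. Each node has a write-once output register in which it may decide a value in $\{0,1\}$. A *run* is an infinite sequence of steps from the initial configuration, in which no message is in transit; time is counted by steps. A node is *non-faulty* in a run if it takes infinitely many steps; a faulty node crashes, i.e. takes no steps after some time. Communication is asynchronous and reliable: every message sent to a non-faulty node is eventually received, with no bound on the delay. The oracle $A$ either returns one fixed value $x\in\{0,1\}$ to all nodes at all times (it *never switches*), or there is $x\in\{0,1\}$ and, for each node $i$, a time $T_i$ such that $i$ obtains $x$ when calling $A$ before $T_i$, and $1-x$ from $T_i$ on. The protocol *solves the binary finality gadget problem with up to $f$ crash faults* if for every such oracle and every run with at most $f$ faulty nodes: - (Agreement) no two non-faulty nodes decide different values; - (Termination) every non-faulty node eventually decides a value; - (Validity) if the oracle never switches and always returns $x$, then non-faulty nodes decide only $x$. **Theorem.** For every $f\ge 1$, and in particular for a single crash fault ($f=1$),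 no deterministic protocol for two or more nodes solves the binary finality gadget problem in a fully asynchronous network with up to $f$ crash faults. -/

import Mathlib

universe u v w

namespace FinalityGadget

/-- The outputs of an oracle on a set `V` of nodes: `A i t` is the value that node `i` obtains
when it calls the oracle at (global) time `t`. -/
abbrev Oracle (V : Type u) : Type u := V → ℕ → Bool

namespace Oracle

variable {V : Type u}

/-- The oracle never switches: it returns `x` to all nodes at all times. -/
def AlwaysReturns (A : Oracle V) (x : Bool) : Prop :=
  ∀ i t, A i t = x

/-- The oracle switches from `x` to `!x`: each node `i` has its own finite switching time `T`. -/
def SwitchesFrom (A : Oracle V) (x : Bool) : Prop :=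
  ∀ i, ∃ T : ℕ, ∀ t, (t < T → A i t = x) ∧ (T ≤ t → A i t = !x)

/-- The oracles of the binary finality gadget problem. -/
def Admissible (A : Oracle V) : Prop :=
  (∃ x, A.AlwaysReturns x) ∨ ∃ x, A.SwitchesFrom x

end Oracle

/-- A deterministic message-passing protocol with access to a binary oracle, for the nodes `V`.

In one atomic step, a node `p` in state `s` receives `m` (a message, or `none` if nothing is
delivered), executes some code in which all calls to the oracle return `x`, goes to the state
`(step p s m x).1`, and sends the finitely many messages `(step p s m x).2`, each of them a pair of
an addressee and a content. A node in state `s` has decided `b` if `output s = some b`, and is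
undecided if `output s = none`; the output is write-once. -/
structure Protocol (V : Type u) where
  /-- contents of messages -/
  Msg : Type v
  /-- local states of nodes -/
  State : Type w
  /-- the initial state of each node -/
  init : V → State
  /-- the transition function -/
  step : V → State → Option Msg → Bool → State × Multiset (V × Msg)
  /-- the output register -/
  output : State → Option Bool
  output_step : ∀ p s m x b, output s = some b → output (step p s m x).1 = some b

namespace Protocol

variable {V : Type u} (P : Protocol.{u, v, w} V)

/-- A configuration: the state of every node, and the multiset of messages (with their addressees)
that have been sent and not yet been received. -/
structure Config where
  state : V → P.State
  buffer : Multiset (V × P.Msg)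

/-- The event `(p, m, x)`: node `p` receives `m` and makes a step in which the oracle returns `x`. -/
structure Event where
  node : V
  msg : Option P.Msg
  oracle : Bool

/-- The initial configuration: all nodes are in their initial states, no message is in transit. -/
def initConfig : P.Config where
  state := P.init
  buffer := 0

variable {P}

/-- The messages (at most one) that an event removes from the buffer. -/
def Event.received (e : P.Event) : Multiset (V × P.Msg) :=
  match e.msg with
  | none => 0
  | some m => {(e.node, m)}

/-- The event `e` is applicable to `c` and leads from `c` to `c'`. -/
def Leads (c : P.Config) (e : P.Event) (c' : P.Config) : Prop :=
  c'.state e.node = (P.step e.node (c.state e.node) e.msg e.oracle).1 ∧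
  (∀ q, q ≠ e.node → c'.state q = c.state q) ∧
  ∃ rest, c.buffer = e.received + rest ∧
    c'.buffer = rest + (P.step e.node (c.state e.node) e.msg e.oracle).2

variable (P) in
/-- An infinite run of the protocol with oracle `A`. Time is counted by the steps of the run. -/
structure Run (A : Oracle V) where
  config : ℕ → P.Config
  event : ℕ → P.Event
  config_zero : config 0 = P.initConfig
  oracle_event : ∀ t, (event t).oracle = A (event t).node t
  leads : ∀ t, Leads (config t) (event t) (config (t + 1))

namespace Run

variable {A : Oracle V} (r : P.Run A)

/-- A node is non-faulty in a run if it takes infinitely many steps. A faulty (crashed) node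
behaves according to the protocol up to some time, and takes no step afterwards. -/
def NonFaulty (p : V) : Prop :=
  ∀ t, ∃ t', t ≤ t' ∧ (r.event t').node = p

/-- Asynchronous reliable communication: every message to a non-faulty node is eventually received,
with no bound on the time that this takes. -/
def Reliable : Prop :=
  ∀ p, r.NonFaulty p → ∀ t m, (p, m) ∈ (r.config t).buffer →
    ∃ t', t ≤ t' ∧ (r.event t').node = p ∧ (r.event t').msg = some m

/-- At most `f` nodes crash in the run. -/
def AtMostFaulty (f : ℕ) : Prop :=
  {p | ¬ r.NonFaulty p}.encard ≤ f

/-- Node `p` decides `b` at some time of the run. -/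
def Decides (p : V) (b : Bool) : Prop :=
  ∃ t, P.output ((r.config t).state p) = some b

end Run

variable (P) in
/-- The protocol solves the binary finality gadget problem in a fully asynchronous network in the
presence of up to `f` crash faults. -/
def SolvesBinaryFinalityGadget (f : ℕ) : Prop :=
  ∀ A : Oracle V, A.Admissible → ∀ r : P.Run A, r.Reliable → r.AtMostFaulty f →
    -- agreement
    (∀ p q, r.NonFaulty p → r.NonFaulty q → ∀ b c, r.Decides p b → r.Decides q c → b = c) ∧
    -- termination
    (∀ p, r.NonFaulty p → ∃ b, r.Decides p b) ∧
    -- validity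
    (∀ x, A.AlwaysReturns x → ∀ p, r.NonFaulty p → ∀ b, r.Decides p b → b = x)

end Protocol

end FinalityGadget

/-! The proof reduces to the theorem of Fischer, Lynch and Paterson. In `latch`, each node replaces
the oracle's value by the disjunction of all values it has seen so far. Whatever bits a run of
`P.latch` uses, each node of `P` then sees `false` up to some point and `true` afterwards. So if
every non-faulty node obtains `true` at least once, the run is one of `P` with an oracle switching
from `false` to `true`, and agreement and termination carry over (`agreesAndTerminates`). Constant
bits pass through the latch unchanged, so validity makes both decisions reachable from the initial
configuration (`SolvesBinaryFinalityGadget.bivalent`). The oracle bit is now mere nondeterminism of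
the scheduler.

For the FLP part, fix a node `p`. As `p` may crash, from every reachable configuration some value
can be decided without `p`. Along a path from a bivalent configuration to a suitable decision there
is a configuration where both values can be decided without `p`; since steps of `p` commute with
such continuations, bivalence survives any step of `p`. `Schedulable.exists_run` turns this into a
fair run that is bivalent infinitely often, so nobody ever decides. -/

namespace FinalityGadget

namespace Protocol

variable {V : Type u} {P : Protocol.{u, v, w} V}

/-! ### Single events -/

@[ext]
theorem Config.ext {c d : P.Config} (hs : c.state = d.state) (hb : c.buffer = d.buffer) :
    c = d := by
  cases c; cases d; simp_all

theorem exists_leads (c : P.Config) (e : P.Event) (h : e.received ≤ c.buffer) :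
    ∃ d, Leads c e d := by
  classical
  obtain ⟨rest, hrest⟩ := Multiset.le_iff_exists_add.1 h
  exact ⟨⟨Function.update c.state e.node (P.step e.node (c.state e.node) e.msg e.oracle).1,
    rest + (P.step e.node (c.state e.node) e.msg e.oracle).2⟩,
    by simp, fun q hq => by simp [hq], rest, hrest, rfl⟩

theorem Leads.unique {c d d' : P.Config} {e : P.Event} (h : Leads c e d) (h' : Leads c e d') :
    d = d' := by
  obtain ⟨h1, h2, r, h3, h4⟩ := h
  obtain ⟨h1', h2', r', h3', h4'⟩ := h'
  have hr : r = r' := add_left_cancel (h3.symm.trans h3')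
  ext1
  · funext q
    by_cases hq : q = e.node
    · rw [hq, h1, h1']
    · rw [h2 q hq, h2' q hq]
  · rw [h4, h4', hr]

theorem Leads.output_eq {c d : P.Config} {e : P.Event} (h : Leads c e d) {q : V} {b : Bool}
    (hb : P.output (c.state q) = some b) : P.output (d.state q) = some b := by
  by_cases hq : q = e.node
  · subst hq
    rw [h.1]
    exact P.output_step _ _ _ _ _ hb
  · rw [h.2.1 q hq, hb]

theorem Leads.mem_buffer {c d : P.Config} {e : P.Event} (h : Leads c e d) {p : V} {m : P.Msg}
    (hm : (p, m) ∈ c.buffer) : (p, m) ∈ d.buffer ∨ e.node = p ∧ e.msg = some m := by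
  obtain ⟨-, -, r, h3, h4⟩ := h
  rw [h3, Multiset.mem_add] at hm
  rw [h4, Multiset.mem_add]
  rcases hm with hm | hm
  · right
    unfold Event.received at hm
    cases hmsg : e.msg <;> simp_all
  · exact Or.inl (Or.inl hm)

/-- Messages received by different nodes are removed from the buffer independently. -/
theorem Event.exists_rest {e e' : P.Event} (hne : e.node ≠ e'.node)
    {B r r' : Multiset (V × P.Msg)} (h : B = e.received + r) (h' : B = e'.received + r') :
    ∃ s, r = e'.received + s ∧ r' = e.received + s := by
  unfold Event.received at *
  cases hm : e.msg with
  | none =>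
    rw [hm] at h
    exact ⟨r', by simp_all, by simp⟩
  | some m =>
    cases hm' : e'.msg with
    | none =>
      rw [hm'] at h'
      exact ⟨r, by simp, by simp_all⟩
    | some m' =>
      rw [hm] at h
      rw [hm'] at h'
      have heq : (e.node, m) ::ₘ r = (e'.node, m') ::ₘ r' := by
        simpa [Multiset.singleton_add] using h.symm.trans h'
      rcases Multiset.cons_eq_cons.1 heq with ⟨h1, -⟩ | ⟨-, s, hs, hs'⟩
      · exact absurd (congrArg Prod.fst h1) hne
      · exact ⟨s, by simpa [Multiset.singleton_add] using hs,
          by simpa [Multiset.singleton_add] using hs'⟩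

/-- Events of different nodes commute. -/
theorem Leads.commute {c c₁ c₂ : P.Config} {e e' : P.Event} (hne : e.node ≠ e'.node)
    (h : Leads c e c₁) (h' : Leads c e' c₂) : ∃ d, Leads c₁ e' d ∧ Leads c₂ e d := by
  classical
  obtain ⟨h1, h2, r, h3, h4⟩ := h
  obtain ⟨h1', h2', r', h3', h4'⟩ := h'
  obtain ⟨s, hs, hs'⟩ := Event.exists_rest hne h3 h3'
  have hst : c₁.state e'.node = c.state e'.node := h2 _ hne.symm
  have hst' : c₂.state e.node = c.state e.node := h2' _ hne
  refine ⟨⟨Function.update c₁.state e'.node (c₂.state e'.node),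
    s + (P.step e.node (c.state e.node) e.msg e.oracle).2 +
      (P.step e'.node (c.state e'.node) e'.msg e'.oracle).2⟩, ⟨?_, ?_, ?_⟩, ⟨?_, ?_, ?_⟩⟩
  · simp [hst, h1']
  · intro q hq
    simp [hq]
  · exact ⟨s + (P.step e.node (c.state e.node) e.msg e.oracle).2,
      by rw [h4, hs, add_assoc], by rw [hst]⟩
  · simp [hne, hst', h1]
  · intro q hq
    by_cases hq' : q = e'.node
    · simp [hq']
    · simp [hq', h2 q hq, h2' q hq']
  · exact ⟨s + (P.step e'.node (c.state e'.node) e'.msg e'.oracle).2,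
      by rw [h4', hs', add_assoc], by rw [hst', add_right_comm]⟩

/-! ### Finite paths -/

/-- `Path c l d`: the events `l`, applied in this order, lead from `c` to `d`. -/
inductive Path : P.Config → List P.Event → P.Config → Prop
  | nil (c : P.Config) : Path c [] c
  | cons {c c' d : P.Config} {e : P.Event} {l : List P.Event} :
      Leads c e c' → Path c' l d → Path c (e :: l) d

theorem Path.append {c d d' : P.Config} {l l' : List P.Event} (h : Path c l d)
    (h' : Path d l' d') : Path c (l ++ l') d' := by
  induction h with
  | nil => exact h'
  | cons h1 _ ih => exact .cons h1 (ih h')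

theorem Leads.path {c d : P.Config} {e : P.Event} (h : Leads c e d) : Path c [e] d :=
  .cons h (.nil d)

theorem Path.output_eq {c d : P.Config} {l : List P.Event} (h : Path c l d) {q : V} {b : Bool}
    (hb : P.output (c.state q) = some b) : P.output (d.state q) = some b := by
  induction h with
  | nil => exact hb
  | cons h1 _ ih => exact ih (h1.output_eq hb)

theorem Path.mem_buffer {c d : P.Config} {l : List P.Event} (h : Path c l d) {p : V} {m : P.Msg}
    (hm : (p, m) ∈ c.buffer) :
    (p, m) ∈ d.buffer ∨ ∃ e ∈ l, e.node = p ∧ e.msg = some m := by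
  induction h with
  | nil => exact Or.inl hm
  | @cons c c' d e l h1 _ ih =>
    rcases h1.mem_buffer hm with h2 | h2
    · rcases ih h2 with h3 | ⟨e', he', h3⟩
      · exact Or.inl h3
      · exact Or.inr ⟨e', List.mem_cons_of_mem _ he', h3⟩
    · exact Or.inr ⟨e, List.mem_cons_self, h2⟩

/-- An event of `p` commutes with a path in which `p` takes no step. -/
theorem Path.commute {c c₁ d : P.Config} {l : List P.Event} {e : P.Event} (h : Path c l d)
    (hl : ∀ e' ∈ l, e'.node ≠ e.node) (he : Leads c e c₁) :
    ∃ d', Path c₁ l d' ∧ Leads d e d' := by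
  induction h generalizing c₁ with
  | nil => exact ⟨c₁, .nil _, he⟩
  | cons h1 _ ih =>
    obtain ⟨c₂, h2, h3⟩ := he.commute (hl _ List.mem_cons_self).symm h1
    obtain ⟨d', h4, h5⟩ := ih (fun e' he' => hl e' (List.mem_cons_of_mem _ he')) h3
    exact ⟨d', .cons h2 h4, h5⟩

variable (P) in
/-- The configurations that some finite sequence of events produces. -/
def Reachable (c : P.Config) : Prop :=
  ∃ l, Path P.initConfig l c

theorem Reachable.path {c d : P.Config} {l : List P.Event} (hc : P.Reachable c)
    (h : Path c l d) : P.Reachable d :=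
  let ⟨_, hl⟩ := hc
  ⟨_, hl.append h⟩

theorem Run.path {A : Oracle V} (r : P.Run A) (n k : ℕ) :
    Path (r.config n) ((List.range' n k).map r.event) (r.config (n + k)) := by
  induction k generalizing n with
  | zero => exact .nil _
  | succ k ih =>
    rw [List.range'_succ, List.map_cons]
    have h := ih (n + 1)
    rw [add_right_comm n 1 k] at h
    exact .cons (r.leads n) h

theorem Run.reachable {A : Oracle V} (r : P.Run A) (t : ℕ) : P.Reachable (r.config t) := by
  have h := r.path 0 t
  rw [r.config_zero, zero_add] at h
  exact ⟨_, h⟩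

theorem Run.output_eq {A : Oracle V} (r : P.Run A) {t t' : ℕ} (h : t ≤ t') {q : V} {b : Bool}
    (hb : P.output ((r.config t).state q) = some b) :
    P.output ((r.config t').state q) = some b := by
  obtain ⟨k, rfl⟩ := Nat.exists_eq_add_of_le h
  exact (r.path t k).output_eq hb

/-! ### Fair scheduling -/

/-- A finite sequence of events that satisfy `E`, leads from `c` to a configuration satisfying `Q`,
contains a step with oracle value `x` of every node in `L`, and the receipt of every
message to a node in `L` that is in transit in `c`. -/
structure FairPlan (L : Set V) (x : Bool) (E : P.Event → Prop) (Q : P.Config → Prop)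
    (c : P.Config) (l : List P.Event) (d : P.Config) : Prop where
  path : Path c l d
  goal : Q d
  events : ∀ e ∈ l, E e
  steps : ∀ p ∈ L, ∃ e ∈ l, e.node = p ∧ e.oracle = x
  receipts : ∀ p ∈ L, ∀ m, (p, m) ∈ c.buffer → ∃ e ∈ l, e.node = p ∧ e.msg = some m

/-- From a configuration with `Q`, and for a node `p` of `L`, there is a path of events satisfying
`E` to a configuration in which every step of `p` leads to a configuration with `Q` again. -/
def Schedulable (L : Set V) (E : P.Event → Prop) (Q : P.Config → Prop) : Prop :=
  ∀ c p, Q c → p ∈ L → ∃ l d, Path c l d ∧ (∀ e ∈ l, E e) ∧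
    ∀ e : P.Event, e.node = p → ∀ d', Leads d e d' → Q d'

theorem Schedulable.exists_path {L : Set V} {x : Bool} {E : P.Event → Prop}
    {Q : P.Config → Prop} (hS : Schedulable L E Q) (hE : ∀ p ∈ L, ∀ m, E ⟨p, m, x⟩)
    (todo : List (V × Option P.Msg)) (htodo : ∀ a ∈ todo, a.1 ∈ L) (c : P.Config) (hc : Q c) :
    ∃ l d, Path c l d ∧ Q d ∧ (∀ e ∈ l, E e) ∧
      (∀ a ∈ todo, ∃ e ∈ l, e.node = a.1 ∧ e.oracle = x) ∧
      ∀ p m, (p, some m) ∈ todo → (p, m) ∈ c.buffer → ∃ e ∈ l, e.node = p ∧ e.msg = some m := by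
  classical
  induction todo generalizing c with
  | nil => exact ⟨[], c, .nil c, hc, by simp, by simp, by simp⟩
  | cons a todo ih =>
    have ha : a.1 ∈ L := htodo a List.mem_cons_self
    obtain ⟨l₁, c₁, hp₁, hE₁, hQ₁⟩ := hS c a.1 hc ha
    obtain ⟨e, he, hx, hrec, hmsg⟩ : ∃ e : P.Event, e.node = a.1 ∧ e.oracle = x ∧
        e.received ≤ c₁.buffer ∧ ∀ m, a.2 = some m → (a.1, m) ∈ c₁.buffer → e.msg = some m := by
      -- The message may already have been received along `l₁`; the node then takes a step without a
      -- message.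
      by_cases h : ∃ m, a.2 = some m ∧ (a.1, m) ∈ c₁.buffer
      · obtain ⟨m, hm, hm'⟩ := h
        refine ⟨⟨a.1, some m, x⟩, rfl, rfl, by simpa [Event.received] using hm', ?_⟩
        intro m' h' _
        exact hm.symm.trans h'
      · exact ⟨⟨a.1, none, x⟩, rfl, rfl, by simp [Event.received],
          fun m hm hm' => absurd ⟨m, hm, hm'⟩ h⟩
    obtain ⟨c₂, h₂⟩ := exists_leads c₁ e hrec
    obtain ⟨l₃, d, hp₃, hQ₃, hE₃, hs₃, hr₃⟩ :=
      ih (fun b hb => htodo b (List.mem_cons_of_mem _ hb)) c₂ (hQ₁ e he c₂ h₂)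
    have hp₂ : Path c (l₁ ++ [e]) c₂ := hp₁.append h₂.path
    have hEe : E e := by
      have := hE a.1 ha e.msg
      rwa [← he, ← hx] at this
    refine ⟨(l₁ ++ [e]) ++ l₃, d, hp₂.append hp₃, hQ₃, ?_, ?_, ?_⟩
    · intro e' he'
      simp only [List.mem_append, List.mem_singleton] at he'
      rcases he' with (h | rfl) | h
      exacts [hE₁ _ h, hEe, hE₃ _ h]
    · intro b hb
      rcases List.mem_cons.1 hb with rfl | hb
      · exact ⟨e, by simp, he, hx⟩
      · obtain ⟨e', he', h⟩ := hs₃ b hb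
        exact ⟨e', List.mem_append_right _ he', h⟩
    · intro p m hpm hbuf
      rcases List.mem_cons.1 hpm with rfl | hpm
      · rcases hp₁.mem_buffer hbuf with h | ⟨e', he', h⟩
        · exact ⟨e, by simp, he, hmsg m rfl h⟩
        · exact ⟨e', by simp [he'], h⟩
      · rcases hp₂.mem_buffer hbuf with h | ⟨e', he', h⟩
        · obtain ⟨e', he', h⟩ := hr₃ p m hpm h
          exact ⟨e', List.mem_append_right _ he', h⟩
        · exact ⟨e', List.mem_append_left _ he', h⟩

/-- Nodes and messages in transit are finite in number, so they form a to-do list; the entries `(p,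
none)` guarantee a step to nodes without mail. -/
theorem Schedulable.exists_fairPlan [Finite V] {L : Set V} {x : Bool} {E : P.Event → Prop}
    {Q : P.Config → Prop} (hS : Schedulable L E Q) (hE : ∀ p ∈ L, ∀ m, E ⟨p, m, x⟩)
    (c : P.Config) (hc : Q c) : ∃ l d, FairPlan L x E Q c l d := by
  classical
  have hL : L.Finite := L.toFinite
  obtain ⟨l, d, h1, h2, h3, h4, h5⟩ := hS.exists_path hE
    (hL.toFinset.toList.map (fun p => (p, none)) ++
      (c.buffer.toList.filter (fun a => a.1 ∈ L)).map (fun a => (a.1, some a.2)))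
    (by
      intro a ha
      simp only [List.mem_append, List.mem_map, List.mem_filter] at ha
      rcases ha with ⟨p, hp, rfl⟩ | ⟨b, hb, rfl⟩
      · simpa using hp
      · simpa using hb.2) c hc
  refine ⟨l, d, h1, h2, h3, fun p hp => h4 (p, none) ?_, fun p hp m hm => h5 p m ?_ hm⟩
  · simp [hp]
  · refine List.mem_append_right _ (List.mem_map.2 ⟨(p, m), ?_, rfl⟩)
    simp [hp, hm]

/-- A path to a configuration with `Q` extends to a run that is fair to the nodes of `L` and
passes through `Q` infinitely often. -/
theorem Schedulable.exists_run [Finite V] {L : Set V} (hL : L.Nonempty) {x : Bool}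
    {E : P.Event → Prop} {Q : P.Config → Prop} (hS : Schedulable L E Q)
    (hE : ∀ p ∈ L, ∀ m, E ⟨p, m, x⟩) {c : P.Config} {l₀ : List P.Event}
    (hl₀ : Path P.initConfig l₀ c) (hc : Q c) :
    ∃ (A : Oracle V) (r : P.Run A), r.config l₀.length = c ∧
      (∀ t, l₀.length ≤ t → E (r.event t)) ∧
      (∀ t, ∃ t', t ≤ t' ∧ Q (r.config t')) ∧
      (∀ p ∈ L, ∀ t, ∃ t', t ≤ t' ∧ (r.event t').node = p ∧ (r.event t').oracle = x) ∧
      ∀ p ∈ L, ∀ t m, (p, m) ∈ (r.config t).buffer →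
        ∃ t', t ≤ t' ∧ (r.event t').node = p ∧ (r.event t').msg = some m := by
  have hplan := hS.exists_fairPlan hE
  have hne : ∀ {c l d}, FairPlan L x E Q c l d → l ≠ [] := by
    rintro c l d h rfl
    obtain ⟨p, hp⟩ := hL
    obtain ⟨e, he, -⟩ := h.steps p hp
    simp at he
  -- A configuration with its pending events, which lead to `Q`. Each step executes the head of the
  -- list; when the list runs out, a new fair plan is loaded.
  let St := {s : P.Config × List P.Event // s.2 ≠ [] ∧ ∃ d, Path s.1 s.2 d ∧ Q d}
  have hnext : ∀ s : St, ∃ s' : St, ∃ e l, s.1.2 = e :: l ∧ Leads s.1.1 e s'.1.1 ∧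
      (s'.1.2 = l ∨ l = [] ∧ Q s'.1.1 ∧ ∃ d, FairPlan L x E Q s'.1.1 s'.1.2 d) := by
    rintro ⟨⟨c, l⟩, h, d, hp, hd⟩
    cases hp with
    | nil => exact absurd rfl h
    | @cons _ c' _ e l h1 h2 =>
      by_cases hl : l = []
      · subst hl
        cases h2
        obtain ⟨l', d', h'⟩ := hplan _ hd
        exact ⟨⟨(_, l'), hne h', d', h'.path, h'.goal⟩, e, [], rfl, h1, Or.inr ⟨rfl, hd, d', h'⟩⟩
      · exact ⟨⟨(c', l), hl, d, h2, hd⟩, e, l, rfl, h1, Or.inl rfl⟩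
  choose nxt ev tl hcons hleads hor using hnext
  obtain ⟨l₁, d₁, h₁⟩ := hplan c hc
  let s₀ : St := ⟨(P.initConfig, l₀ ++ l₁), by simp [hne h₁], d₁, hl₀.append h₁.path, h₁.goal⟩
  let s : ℕ → St := fun n => Nat.rec s₀ (fun _ => nxt) n
  -- Only one node moves at each time, so the bits of the events define an oracle, in general not an
  -- admissible one.
  let r : P.Run (fun _ t => (ev (s t)).oracle) :=
    { config := fun t => (s t).1.1
      event := fun t => ev (s t)
      config_zero := rfl
      oracle_event := fun _ => rfl
      leads := fun t => hleads (s t) }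
  -- Any prefix `l` of the pending list is executed as planned; `l'` is then what remains, or a
  -- fresh plan starts if `l'` is empty.
  have hfollow : ∀ l n l', (s n).1.2 = l ++ l' →
      (∀ e ∈ l, ∃ t, n ≤ t ∧ r.event t = e) ∧
      (∀ d, Path (s n).1.1 l d → (s (n + l.length)).1.1 = d) ∧
      (l' ≠ [] → (s (n + l.length)).1.2 = l') ∧
      (l' = [] → l ≠ [] → Q (s (n + l.length)).1.1 ∧
        ∃ d, FairPlan L x E Q (s (n + l.length)).1.1 (s (n + l.length)).1.2 d) := by
    intro l
    induction l with
    | nil =>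
      intro n l' h
      refine ⟨by simp, ?_, fun _ => h, fun _ h => absurd rfl h⟩
      intro d hd
      cases hd
      rfl
    | cons e l ih =>
      intro n l' h
      have h1 := hcons (s n)
      rw [h, List.cons_append, List.cons.injEq] at h1
      obtain ⟨he, htl⟩ := h1
      have hlead : Leads (s n).1.1 e (s (n + 1)).1.1 := by
        rw [he]
        exact hleads (s n)
      have hlen : n + (e :: l).length = n + 1 + l.length := by
        rw [List.length_cons]; omega
      rw [hlen]
      by_cases hnil : l ++ l' = []
      · obtain ⟨rfl, rfl⟩ := List.append_eq_nil_iff.1 hnil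
        refine ⟨?_, ?_, fun h => absurd rfl h, fun _ _ => ?_⟩
        · intro e' he'
          rw [List.mem_singleton.1 he']
          exact ⟨n, le_rfl, he.symm⟩
        · intro d hd
          cases hd with
          | cons h2 h3 =>
            cases h3
            exact hlead.unique h2
        · rcases hor (s n) with h2 | ⟨-, h2⟩
          · exact absurd (h2.trans htl.symm) (s (n + 1)).2.1
          · exact h2
      · have h2 : (s (n + 1)).1.2 = l ++ l' := by
          rcases hor (s n) with h2 | ⟨h2, -⟩
          · exact h2.trans htl.symm
          · exact absurd (htl.trans h2) hnil
        obtain ⟨i1, i2, i3, i4⟩ := ih (n + 1) l' h2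
        refine ⟨?_, ?_, i3, fun h3 _ => i4 h3 ?_⟩
        · intro e' he'
          rcases List.mem_cons.1 he' with rfl | he'
          · exact ⟨n, le_rfl, he.symm⟩
          · obtain ⟨t, ht, h4⟩ := i1 e' he'
            exact ⟨t, by omega, h4⟩
        · intro d hd
          cases hd with
          | cons h3 h4 =>
            rw [← hlead.unique h3] at h4
            exact i2 d h4
        · rintro rfl
          exact hnil (by simp [h3])
  have hfresh : ∀ t, ∃ t', t ≤ t' ∧ Q (r.config t') ∧
      ∃ d, FairPlan L x E Q (s t').1.1 (s t').1.2 d := by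
    intro t
    have h := (hfollow (s t).1.2 t [] (by simp)).2.2.2 rfl (s t).2.1
    exact ⟨_, Nat.le_add_right _ _, h⟩
  have hmem : ∀ t, r.event t ∈ (s t).1.2 := by
    intro t
    rw [hcons (s t)]
    exact List.mem_cons_self
  have hstart := hfollow l₀ 0 l₁ rfl
  rw [zero_add] at hstart
  refine ⟨_, r, hstart.2.1 c hl₀, ?_, ?_, ?_, ?_⟩
  · have hall : ∀ t, l₀.length ≤ t → ∀ e ∈ (s t).1.2, E e := by
      intro t ht
      induction t, ht using Nat.le_induction with
      | base =>
        rw [hstart.2.2.1 (hne h₁)]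
        exact h₁.events
      | succ t _ ih =>
        rcases hor (s t) with h | ⟨-, -, d, h⟩
        · intro e he
          refine ih e ?_
          rw [hcons (s t), ← h]
          exact List.mem_cons_of_mem _ he
        · exact h.events
    exact fun t ht => hall t ht _ (hmem t)
  · intro t
    obtain ⟨t', ht', h, -⟩ := hfresh t
    exact ⟨t', ht', h⟩
  · intro p hp t
    obtain ⟨t', ht', -, d, h⟩ := hfresh t
    obtain ⟨e, he, h1⟩ := h.steps p hp
    obtain ⟨t'', ht'', rfl⟩ := (hfollow _ t' [] (List.append_nil _).symm).1 e he
    exact ⟨t'', ht'.trans ht'', h1⟩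
  · intro p hp t m hm
    obtain ⟨t', ht', -, d, h⟩ := hfresh t
    obtain ⟨k, rfl⟩ := Nat.exists_eq_add_of_le ht'
    rcases (r.path t k).mem_buffer hm with h1 | ⟨e, he, h1⟩
    · obtain ⟨e, he, h2⟩ := h.receipts p hp m h1
      obtain ⟨t'', ht'', rfl⟩ := (hfollow _ _ [] (List.append_nil _).symm).1 e he
      exact ⟨t'', ht'.trans ht'', h2⟩
    · obtain ⟨t'', ht'', rfl⟩ := List.mem_map.1 he
      exact ⟨t'', (List.mem_range'_1.1 ht'').1, h1⟩

/-- With a trivial goal only fairness and `E` matter: this gives crash-free runs, runs in which one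
node stops, and runs with a constant bit. -/
theorem schedulable_true (L : Set V) (E : P.Event → Prop) :
    Schedulable L E (fun _ => True) :=
  fun c _ _ _ => ⟨[], c, .nil c, by simp, fun _ _ _ _ => trivial⟩

/-! ### Bivalent configurations -/

/-- Some node has decided `b`. -/
def Decided (c : P.Config) (b : Bool) : Prop :=
  ∃ q, P.output (c.state q) = some b

theorem Path.decided {c d : P.Config} {l : List P.Event} (h : Path c l d) {b : Bool}
    (hb : Decided c b) : Decided d b :=
  let ⟨q, hq⟩ := hb
  ⟨q, h.output_eq hq⟩

/-- Both decisions can be reached. -/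
def Bivalent (c : P.Config) : Prop :=
  ∀ b, ∃ l d, Path c l d ∧ Decided d b

/-- The decision `b` can be reached without any step of `p`. -/
def SilentlyDecidable (p : V) (c : P.Config) (b : Bool) : Prop :=
  ∃ l d, Path c l d ∧ (∀ e ∈ l, e.node ≠ p) ∧ Decided d b

theorem SilentlyDecidable.of_leads {p : V} {c c' : P.Config} {b : Bool} {e : P.Event}
    (h : SilentlyDecidable p c' b) (hc : Leads c e c') (he : e.node ≠ p) :
    SilentlyDecidable p c b := by
  obtain ⟨l, d, h1, h2, h3⟩ := h
  exact ⟨e :: l, d, .cons hc h1, List.forall_mem_cons.2 ⟨he, h2⟩, h3⟩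

/-- A step of `p` commutes with the deciding path, which avoids `p`, and decisions are irrevocable.
-/
theorem SilentlyDecidable.leads {p : V} {c c' : P.Config} {b : Bool} {e : P.Event}
    (h : SilentlyDecidable p c b) (hc : Leads c e c') (he : e.node = p) :
    SilentlyDecidable p c' b := by
  subst he
  obtain ⟨l, d, h1, h2, h3⟩ := h
  obtain ⟨d', h4, h5⟩ := h1.commute h2 hc
  exact ⟨l, d', h4, h2, h5.path.decided h3⟩

/-- On the way from a configuration where `b` is silently decidable to one where `!b` is
decided, there is one where both values are silently decidable. -/
theorem Path.exists_silentlyDecidable {p : V}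
    (hterm : ∀ c, P.Reachable c → ∃ b, SilentlyDecidable p c b)
    {c d : P.Config} {l : List P.Event} {b : Bool} (h : Path c l d) (hc : P.Reachable c)
    (hb : SilentlyDecidable p c b) (hd : Decided d !b) :
    ∃ l' c', Path c l' c' ∧ ∀ b', SilentlyDecidable p c' b' := by
  have both : ∀ {c : P.Config}, SilentlyDecidable p c b → SilentlyDecidable p c (!b) →
      ∀ b', SilentlyDecidable p c b' := by
    intro c h1 h2 b'
    by_cases hb' : b' = b
    · exact hb' ▸ h1
    · rwa [Bool.eq_not.2 hb']
  induction h with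
  | nil c => exact ⟨[], c, .nil c, both hb ⟨[], c, .nil c, by simp, hd⟩⟩
  | @cons c c₁ d e l h1 _ ih =>
    by_cases hb1 : SilentlyDecidable p c₁ b
    · obtain ⟨l', c', h2, h3⟩ := ih (hc.path h1.path) hb1 hd
      exact ⟨e :: l', c', .cons h1 h2, h3⟩
    -- The step that loses `b` is not made by `p`, so the value silently decidable after it,
    -- necessarily `!b`, was so before it too.
    · have he : e.node ≠ p := fun he => hb1 (hb.leads h1 he)
      obtain ⟨b', hb'⟩ := hterm c₁ (hc.path h1.path)
      have : b' = !b := Bool.eq_not.2 fun h => hb1 (h ▸ hb')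
      subst this
      exact ⟨[], c, .nil c, both hb (hb'.of_leads h1 he)⟩

/-- No message is fixed in advance: once both values are silently decidable, every event of `p`
keeps them reachable. -/
theorem schedulable_bivalent
    (hterm : ∀ p c, P.Reachable c → ∃ b, SilentlyDecidable p c b) :
    Schedulable Set.univ (fun _ => True) (fun c : P.Config => P.Reachable c ∧ Bivalent c) := by
  rintro c p ⟨hc, hbiv⟩ -
  obtain ⟨b, hb⟩ := hterm p c hc
  obtain ⟨l, d, hl, hd⟩ := hbiv !b
  obtain ⟨l', c', h1, h2⟩ := hl.exists_silentlyDecidable (hterm p) hc hb hd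
  refine ⟨l', c', h1, by simp, fun e he d' hd' => ⟨(hc.path h1).path hd'.path, fun b' => ?_⟩⟩
  obtain ⟨l'', d'', h3, -, h4⟩ := (h2 b').leads hd' he
  exact ⟨l'', d'', h3, h4⟩

/-- Agreement and termination, in all reliable runs with at most one faulty node where every
non-faulty node makes some step with oracle value `true`. -/
def AgreesAndTerminates (P : Protocol.{u, v, w} V) : Prop :=
  ∀ (A : Oracle V) (r : P.Run A), r.Reliable → r.AtMostFaulty 1 →
    (∀ p, r.NonFaulty p → ∃ t, (r.event t).node = p ∧ (r.event t).oracle = true) →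
    (∀ p q, r.NonFaulty p → r.NonFaulty q → ∀ b c, r.Decides p b → r.Decides q c → b = c) ∧
    ∀ p, r.NonFaulty p → ∃ b, r.Decides p b

theorem Run.atMostFaulty_of_forall {A : Oracle V} {r : P.Run A} (h : ∀ p, r.NonFaulty p)
    (f : ℕ) : r.AtMostFaulty f := by
  simp [Run.AtMostFaulty, h]

/-- Continuing from `c` with no crash makes both deciders non-faulty. -/
theorem AgreesAndTerminates.agree [Finite V] (H : AgreesAndTerminates P) {c : P.Config}
    (hc : P.Reachable c) {b b' : Bool} (hb : Decided c b) (hb' : Decided c b') : b = b' := by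
  obtain ⟨l, hl⟩ := hc
  obtain ⟨p, hp⟩ := hb
  obtain ⟨q, hq⟩ := hb'
  obtain ⟨A, r, h1, -, -, h2, h3⟩ := (schedulable_true Set.univ fun _ => True).exists_run
    ⟨p, Set.mem_univ p⟩ (x := true) (by simp) hl trivial
  have hnf : ∀ p, r.NonFaulty p := fun p t =>
    let ⟨t', ht', h, _⟩ := h2 p trivial t
    ⟨t', ht', h⟩
  refine (H A r (fun p _ => h3 p trivial) (Run.atMostFaulty_of_forall hnf 1) fun p _ => ?_).1
    p q (hnf p) (hnf q) b b' ⟨l.length, by rw [h1, hp]⟩ ⟨l.length, by rw [h1, hq]⟩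
  obtain ⟨t, -, h⟩ := h2 p trivial 0
  exact ⟨t, h⟩

/-- Crash `p` at `c` and run the others fairly: termination makes another node decide. -/
theorem AgreesAndTerminates.exists_silentlyDecidable [Finite V] [Nontrivial V]
    (H : AgreesAndTerminates P) (p : V) (c : P.Config) (hc : P.Reachable c) :
    ∃ b, SilentlyDecidable p c b := by
  obtain ⟨l, hl⟩ := hc
  obtain ⟨q, hq⟩ := exists_ne p
  obtain ⟨A, r, h1, hE, -, h2, h3⟩ :=
    (schedulable_true {p}ᶜ fun e => e.node ≠ p).exists_run ⟨q, hq⟩ (x := true)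
      (fun _ h _ => h) hl trivial
  have hnf : ∀ q, q ≠ p → r.NonFaulty q := fun q hq t =>
    let ⟨t', ht', h, _⟩ := h2 q hq t
    ⟨t', ht', h⟩
  have hne : ∀ q, r.NonFaulty q → q ≠ p := by
    intro q hq hqp
    obtain ⟨t, ht, h⟩ := hq l.length
    exact hE t ht (h.trans hqp)
  have hfaulty : r.AtMostFaulty 1 := by
    refine (Set.encard_le_encard (t := {p}) fun q hq => ?_).trans (by simp)
    by_contra hqp
    exact hq (hnf q hqp)
  obtain ⟨b, t, ht⟩ := (H A r (fun q hq => h3 q (hne q hq)) hfaulty fun q hq => by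
    obtain ⟨t, -, h⟩ := h2 q (hne q hq) 0
    exact ⟨t, h⟩).2 q (hnf q hq)
  -- The decision time `t` may precede `c`; time `l.length + t` is after both.
  refine ⟨b, _, _, h1 ▸ r.path l.length t, ?_, q, r.output_eq (Nat.le_add_left _ _) ht⟩
  intro e he
  obtain ⟨t', ht', rfl⟩ := List.mem_map.1 he
  exact hE t' (List.mem_range'_1.1 ht').1

/-- The theorem of Fischer, Lynch and Paterson. -/
theorem AgreesAndTerminates.not_bivalent [Finite V] [Nontrivial V]
    (H : AgreesAndTerminates P) : ¬ Bivalent P.initConfig := by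
  intro hbiv
  obtain ⟨p⟩ : Nonempty V := inferInstance
  obtain ⟨A, r, -, -, hQ, h2, h3⟩ :=
    (schedulable_bivalent H.exists_silentlyDecidable).exists_run ⟨p, Set.mem_univ p⟩
      (x := true) (by simp) (.nil _) ⟨⟨[], .nil _⟩, hbiv⟩
  have hnf : ∀ p, r.NonFaulty p := fun p t =>
    let ⟨t', ht', h, _⟩ := h2 p trivial t
    ⟨t', ht', h⟩
  obtain ⟨b, t, ht⟩ := (H A r (fun q _ => h3 q trivial) (Run.atMostFaulty_of_forall hnf 1)
    fun q _ => by
      obtain ⟨t, -, h⟩ := h2 q trivial 0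
      exact ⟨t, h⟩).2 p (hnf p)
  obtain ⟨t', ht', hr, hb⟩ := hQ t
  obtain ⟨l, d, hl, hd⟩ := hb !b
  have hd' : Decided d b := hl.decided ⟨p, r.output_eq ht' ht⟩
  exact (Bool.eq_not_self b).1 (H.agree (hr.path hl) hd' hd)

/-! ### Eliminating the oracle -/

/-- The protocol in which every node remembers whether it has obtained `true` from the oracle, and
takes the value of the oracle to be `true` from then on. -/
def latch (P : Protocol.{u, v, w} V) : Protocol.{u, v, w} V where
  Msg := P.Msg
  State := P.State × Bool
  init p := (P.init p, false)
  step p s m x :=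
    (((P.step p s.1 m (s.2 || x)).1, s.2 || x), (P.step p s.1 m (s.2 || x)).2)
  output s := P.output s.1
  output_step p s m x b h := P.output_step p s.1 m (s.2 || x) b h

namespace Run

variable {A' : Oracle V} (r : P.latch.Run A')

/-- The latch of node `p` at time `t`. -/
def flag (p : V) (t : ℕ) : Bool :=
  ((r.config t).state p).2

theorem flag_succ_self (t : ℕ) : r.flag (r.event t).node (t + 1) =
    (r.flag (r.event t).node t || (r.event t).oracle) :=
  congrArg Prod.snd (r.leads t).1

theorem flag_succ_of_ne {t : ℕ} {q : V} (h : q ≠ (r.event t).node) :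
    r.flag q (t + 1) = r.flag q t :=
  congrArg Prod.snd ((r.leads t).2.1 q h)

theorem flag_zero (p : V) : r.flag p 0 = false := by
  unfold flag
  rw [r.config_zero]
  rfl

theorem flag_mono {p : V} {t t' : ℕ} (h : t ≤ t') (ht : r.flag p t = true) :
    r.flag p t' = true := by
  induction t', h using Nat.le_induction with
  | base => exact ht
  | succ t' _ ih =>
    by_cases hp : p = (r.event t').node
    · subst hp
      rw [flag_succ_self, ih, Bool.true_or]
    · rw [flag_succ_of_ne r hp, ih]

/-- A run of `P.latch`, as a run of `P`. -/
def unlatch (A : Oracle V)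
    (hA : ∀ t, r.flag (r.event t).node (t + 1) = A (r.event t).node t) : P.Run A where
  config t := ⟨fun p => ((r.config t).state p).1, (r.config t).buffer⟩
  -- The latch is updated before `P` reads it, hence `t + 1`.
  event t := ⟨(r.event t).node, (r.event t).msg, r.flag (r.event t).node (t + 1)⟩
  config_zero := by
    rw [r.config_zero]
    rfl
  oracle_event := hA
  leads t := by
    obtain ⟨h1, h2, rest, h3, h4⟩ := r.leads t
    have hf := r.flag_succ_self t
    refine ⟨?_, fun q hq => congrArg Prod.fst (h2 q hq), rest, ?_, ?_⟩
    · dsimp only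
      rw [hf]
      exact congrArg Prod.fst h1
    · refine h3.trans (congrArg (· + rest) ?_)
      unfold Event.received
      dsimp only
      cases (r.event t).msg <;> rfl
    · dsimp only
      rw [hf]
      exact h4

open Classical in
/-- The oracle of a run of `P.latch`: a node obtains `true` once its latch is closed, or
it has crashed. -/
noncomputable def latchOracle : Oracle V := fun p t =>
  -- The default `true` makes a node switch even if it crashes with its latch open; no step reads
  -- it.
  if ∃ t', t ≤ t' ∧ (r.event t').node = p then r.flag p (t + 1) else true

theorem switchesFrom_latchOracle
    (h : ∀ p, r.NonFaulty p → ∃ t, (r.event t).node = p ∧ (r.event t).oracle = true) :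
    r.latchOracle.SwitchesFrom false := by
  classical
  intro p
  have hex : ∃ t, r.latchOracle p t = true := by
    by_cases hp : r.NonFaulty p
    · obtain ⟨t, rfl, ht⟩ := h p hp
      refine ⟨t, ?_⟩
      rw [latchOracle, if_pos ⟨t, le_rfl, rfl⟩, flag_succ_self, ht, Bool.or_true]
    · unfold NonFaulty at hp
      push Not at hp
      obtain ⟨t, ht⟩ := hp
      refine ⟨t, if_neg ?_⟩
      rintro ⟨t', h1, h2⟩
      exact ht t' h1 h2
  refine ⟨Nat.find hex, fun t => ⟨fun ht => ?_, fun ht => ?_⟩⟩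
  · simpa using Nat.find_min hex ht
  · have h0 := Nat.find_spec hex
    generalize Nat.find hex = T at ht h0
    unfold latchOracle at h0 ⊢
    split_ifs with h1
    · obtain ⟨t', h1, h2⟩ := h1
      -- A step of `p` after `t` is also after `T`, so the value at `T` was the latch, which stays
      -- closed.
      rw [if_pos ⟨t', ht.trans h1, h2⟩] at h0
      exact r.flag_mono (by omega) h0
    · rfl

end Run

/-- Unlatching keeps nodes, messages and outputs, so reliability, faults and decisions transfer
definitionally. -/
theorem SolvesBinaryFinalityGadget.agreesAndTerminates {f : ℕ} (hf : 1 ≤ f)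
    (h : P.SolvesBinaryFinalityGadget f) : AgreesAndTerminates P.latch := by
  intro A' r hrel hfaulty horacle
  let r' : P.Run r.latchOracle := r.unlatch r.latchOracle fun t => by
    rw [Run.latchOracle, if_pos ⟨t, le_rfl, rfl⟩]
  have hres := h r.latchOracle (Or.inr ⟨false, r.switchesFrom_latchOracle horacle⟩) r' hrel
    (le_trans hfaulty (by exact_mod_cast hf))
  exact ⟨hres.1, hres.2.1⟩

theorem SolvesBinaryFinalityGadget.bivalent [Finite V] [Nonempty V] {f : ℕ}
    (h : P.SolvesBinaryFinalityGadget f) : Bivalent P.latch.initConfig := by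
  intro x
  obtain ⟨p⟩ : Nonempty V := inferInstance
  obtain ⟨A', r, -, hE, -, h2, h3⟩ :=
    (schedulable_true (P := P.latch) Set.univ fun e => e.oracle = x).exists_run ⟨p, Set.mem_univ p⟩
      (x := x) (by simp) (.nil _) trivial
  -- For `true` the latch closes at a node's first step, before `P` reads it; for `false` no latch
  -- ever closes.
  have hflag : ∀ t, r.flag (r.event t).node (t + 1) = x := by
    intro t
    have hx : ∀ t, (r.event t).oracle = x := fun t => hE t (Nat.zero_le t)
    cases x with
    | true => rw [r.flag_succ_self, hx, Bool.or_true]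
    | false =>
      have hfalse : ∀ t q, r.flag q t = false := by
        intro t
        induction t with
        | zero => exact r.flag_zero
        | succ t ih =>
          intro q
          by_cases hq : q = (r.event t).node
          · rw [hq, r.flag_succ_self, hx, ih, Bool.or_false]
          · rw [r.flag_succ_of_ne hq, ih]
      exact hfalse _ _
  let r' : P.Run (fun _ _ => x) := r.unlatch (fun _ _ => x) hflag
  have hnf : ∀ p, r'.NonFaulty p := fun p t =>
    let ⟨t', ht', h, _⟩ := h2 p trivial t
    ⟨t', ht', h⟩
  have hconst : Oracle.AlwaysReturns (fun (_ : V) _ => x) x := fun _ _ => rfl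
  obtain ⟨-, hterm, hvalid⟩ := h _ (Or.inl ⟨x, hconst⟩) r' (fun p _ => h3 p trivial)
    (Run.atMostFaulty_of_forall hnf f)
  obtain ⟨b, hb⟩ := hterm p (hnf p)
  obtain rfl := hvalid x hconst p (hnf p) b hb
  obtain ⟨t, ht⟩ := hb
  obtain ⟨l, hl⟩ := r.reachable t
  exact ⟨l, _, hl, p, ht⟩

end Protocol

end FinalityGadget

theorem mainTheorem1 {V : Type u} [Fintype V] (hV : 2 ≤ Fintype.card V)
    (P : FinalityGadget.Protocol.{u, v, w} V) (f : ℕ) (hf : 1 ≤ f) :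
    ¬ P.SolvesBinaryFinalityGadget f := by
  intro h
  have : Nontrivial V := Fintype.one_lt_card_iff_nontrivial.1 hV
  exact (h.agreesAndTerminates hf).not_bivalent h.bivalent
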